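/- **Corollary.** Let $K\subset\mathbb R^d$ be a convex compact set, let $C(K)$ be the space of continuous functions $f:K\to\mathbb R$ with the uniform norm $\|f\|_{C(K)}=\max_{x\in K}|f(x)|$, and let $\Delta\subset C(K)$ be the set of all convex and continuous functions on $K$. Let $E_d$ be the set of all exponential polynomials $$E(x)=\sum_{j=1}^{n}c_j\,e^{\alpha_j\cdot x}=\sum_{j=1}^{n}c_j\exp\Big\{\sum_{k=1}^{d}\alpha_{j,k}x_k\Big\},\qquad x=(x_1,\dots,x_d)\in\mathbb R^d,$$ with $n\in\mathbb N$, $c_j\in\mathbb R$ and $\alpha_j=(\alpha_{j,1},\dots,\alpha_{j,d})\in\mathbb Z_+^d$, where $\mathbb Z_+$ is the set of non-negative integers; functions in $E_d$ are regarded as elements of $C(K)$ by restriction to $K$. Then $$\Delta=\overline{E_d\cap\Delta},$$ where the bar denotes the closure in $C(K)$ with respect to the uniform norm. In particular, every continuous convex function on $K$ is a uniform limit on $K$ of exponential polynomials from $E_d$ that are themselves convex on $K$. -/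

import Mathlib

/-- The set `E_d` of exponential polynomials on `ℝ^d`: all functions
`x ↦ ∑ j, c j * exp (α j ⬝ x)`, a finite sum with real coefficients `c j` and exponent vectors
`α j` having non-negative integer coordinates. -/
def expPolynomials (d : ℕ) : Set (EuclideanSpace ℝ (Fin d) → ℝ) :=
  {E | ∃ (n : ℕ) (c : Fin n → ℝ) (α : Fin n → Fin d → ℕ),
    ∀ x, E x = ∑ j, c j * Real.exp (∑ k, (α j k : ℝ) * x k)}

/-- `E_d` viewed inside `C(K)`: the restrictions to `K` of exponential polynomials. -/
def expPolynomialsOn {d : ℕ} (K : Set (EuclideanSpace ℝ (Fin d))) : Set C(K, ℝ) :=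
  {f | ∃ E ∈ expPolynomials d, ∀ x : K, f x = E x}

/-- The set `Δ` of convex and continuous functions on `K`. Continuity is built into `C(K, ℝ)`;
as `ConvexOn` is about functions on the whole space, convexity of `f` on `K` is expressed through
a function `F` on the whole space with the same values on `K`
(the values of `F` outside `K` are irrelevant). -/
def convexContinuousOn {d : ℕ} (K : Set (EuclideanSpace ℝ (Fin d))) : Set C(K, ℝ) :=
  {f | ∃ F : EuclideanSpace ℝ (Fin d) → ℝ, ConvexOn ℝ K F ∧ ∀ x : K, f x = F x}

/-! Δ is closed, so the point is density. Convolving with a kernel from E_d gives a member of E_d,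
and averaging translates against a nonnegative kernel preserves convexity. But such a kernel peaks
only on a bounded ball, so the function must first be cut off, which destroys convexity.

The cutoff keeps semiconvexity: the given function is replaced by a Lipschitz convex G on the whole
space, then by a compactly supported f equal to G near K with f + A‖x‖² convex
(`exists_semiconvex_truncation`). Only shifts s with ‖s‖ ≥ 1 see the non-convex region, so the
convexity defect of the average is at most A times the first moment of the kernel. Powers of one
element of E_d make this moment arbitrarily small (`exists_expPolynomial_peak`). A small multiple of
∑ exp(x_i), strongly convex on K and itself in E_d, then absorbs the defect. -/

/-! ### Algebra of exponential polynomials -/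

/-- A finite combination of exponentials over an arbitrary finite index type lies in `E_d`. -/
theorem expPolynomials_of_fintype {d : ℕ} {ι : Type*} [Fintype ι] (c : ι → ℝ)
    (α : ι → Fin d → ℕ) :
    (fun x => ∑ j, c j * Real.exp (∑ k, (α j k : ℝ) * x k)) ∈ expPolynomials d := by
  refine ⟨Fintype.card ι, c ∘ (Fintype.equivFin ι).symm, α ∘ (Fintype.equivFin ι).symm,
    fun x => ?_⟩
  exact ((Fintype.equivFin ι).symm.sum_comp
    (fun j => c j * Real.exp (∑ k, (α j k : ℝ) * x k))).symm

theorem expPolynomials_add {d : ℕ} {f g : EuclideanSpace ℝ (Fin d) → ℝ}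
    (hf : f ∈ expPolynomials d) (hg : g ∈ expPolynomials d) :
    (fun x => f x + g x) ∈ expPolynomials d := by
  obtain ⟨n, c, α, h⟩ := hf
  obtain ⟨m, b, β, h'⟩ := hg
  convert expPolynomials_of_fintype (Sum.elim c b) (Sum.elim α β) using 2 with x
  simp [h, h']

theorem expPolynomials_mul {d : ℕ} {f g : EuclideanSpace ℝ (Fin d) → ℝ}
    (hf : f ∈ expPolynomials d) (hg : g ∈ expPolynomials d) :
    (fun x => f x * g x) ∈ expPolynomials d := by
  obtain ⟨n, c, α, h⟩ := hf
  obtain ⟨m, b, β, h'⟩ := hg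
  convert expPolynomials_of_fintype (fun p : Fin n × Fin m => c p.1 * b p.2)
    (fun p => α p.1 + β p.2) using 2 with x
  rw [h, h', Finset.sum_mul_sum, Fintype.sum_prod_type]
  refine Finset.sum_congr rfl fun i _ => Finset.sum_congr rfl fun j _ => ?_
  simp only [Pi.add_apply, Nat.cast_add, add_mul, Finset.sum_add_distrib, Real.exp_add]
  ring

theorem expPolynomials_const {d : ℕ} (a : ℝ) :
    (fun _ => a : EuclideanSpace ℝ (Fin d) → ℝ) ∈ expPolynomials d :=
  ⟨1, fun _ => a, fun _ _ => 0, fun x => by simp⟩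

theorem expPolynomials_exp {d : ℕ} (k : Fin d) :
    (fun x => Real.exp (x k) : EuclideanSpace ℝ (Fin d) → ℝ) ∈ expPolynomials d :=
  ⟨1, fun _ => 1, fun _ => Pi.single k 1, fun x => by simp [Pi.single_apply]⟩

theorem expPolynomials_sum {d : ℕ} {ι : Type*} (s : Finset ι)
    {f : ι → EuclideanSpace ℝ (Fin d) → ℝ} (hf : ∀ i, f i ∈ expPolynomials d) :
    (fun x => ∑ i ∈ s, f i x) ∈ expPolynomials d := by
  classical
  induction s using Finset.induction_on with
  | empty => simpa using expPolynomials_const 0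
  | insert a s ha ih =>
    simp only [Finset.sum_insert ha]
    exact expPolynomials_add (hf a) ih

theorem expPolynomials_pow {d : ℕ} {f : EuclideanSpace ℝ (Fin d) → ℝ}
    (hf : f ∈ expPolynomials d) (n : ℕ) : (fun x => f x ^ n) ∈ expPolynomials d := by
  induction n with
  | zero => simpa using expPolynomials_const 1
  | succ n ih => simpa only [pow_succ] using expPolynomials_mul ih hf

theorem expPolynomials_continuous {d : ℕ} {f : EuclideanSpace ℝ (Fin d) → ℝ}
    (hf : f ∈ expPolynomials d) : Continuous f := by
  obtain ⟨n, c, α, h⟩ := hf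
  rw [funext h]
  fun_prop

open MeasureTheory in
/-- Convolving a compactly supported continuous function with an exponential polynomial yields an
exponential polynomial. -/
theorem expPolynomials_convolution {d : ℕ} {f k : EuclideanSpace ℝ (Fin d) → ℝ}
    (hf : Continuous f) (hfs : HasCompactSupport f) (hk : k ∈ expPolynomials d) :
    (fun x => ∫ t, f t * k (x - t)) ∈ expPolynomials d := by
  obtain ⟨n, c, α, h⟩ := hk
  refine ⟨n, fun j => c j * ∫ t, f t * Real.exp (-∑ k, (α j k : ℝ) * t k), α, fun x => ?_⟩
  have hint (j : Fin n) : Integrable fun t : EuclideanSpace ℝ (Fin d) =>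
      f t * Real.exp (-∑ k, (α j k : ℝ) * t k) :=
    (by fun_prop : Continuous _).integrable_of_hasCompactSupport hfs.mul_right
  have hexp (t : EuclideanSpace ℝ (Fin d)) : f t * k (x - t) =
      ∑ j, c j * Real.exp (∑ k, (α j k : ℝ) * x k) *
        (f t * Real.exp (-∑ k, (α j k : ℝ) * t k)) := by
    rw [h, Finset.mul_sum]
    refine Finset.sum_congr rfl fun j _ => ?_
    simp only [PiLp.sub_apply, mul_sub, Finset.sum_sub_distrib]
    rw [sub_eq_add_neg, Real.exp_add]
    ring
  simp only [hexp]
  rw [integral_finsetSum _ fun j _ => (hint j).const_mul _]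
  refine Finset.sum_congr rfl fun j _ => ?_
  rw [integral_const_mul]
  ring

/-! ### Closedness of Δ -/

/-- Membership in `Δ` as a family of inequalities between values on `K`. -/
theorem mem_convexContinuousOn_iff {d : ℕ} {K : Set (EuclideanSpace ℝ (Fin d))}
    (hconv : Convex ℝ K) (f : C(K, ℝ)) :
    f ∈ convexContinuousOn K ↔ ∀ (x y : K) (a b : ℝ) (ha : 0 ≤ a) (hb : 0 ≤ b) (hab : a + b = 1),
      f ⟨a • (x : EuclideanSpace ℝ (Fin d)) + b • (y : EuclideanSpace ℝ (Fin d)),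
        hconv x.2 y.2 ha hb hab⟩ ≤ a * f x + b * f y := by
  classical
  constructor
  · rintro ⟨F, hF, h⟩ x y a b ha hb hab
    simpa [h] using hF.2 x.2 y.2 ha hb hab
  · intro h
    refine ⟨fun x => if hx : x ∈ K then f ⟨x, hx⟩ else 0, ⟨hconv, ?_⟩, fun x => by simp⟩
    intro x hx y hy a b ha hb hab
    simpa [hx, hy, hconv hx hy ha hb hab] using h ⟨x, hx⟩ ⟨y, hy⟩ a b ha hb hab

theorem isClosed_convexContinuousOn {d : ℕ} {K : Set (EuclideanSpace ℝ (Fin d))}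
    (hconv : Convex ℝ K) : IsClosed (convexContinuousOn K) := by
  have : convexContinuousOn K = {f : C(K, ℝ) | ∀ (x y : K) (a b : ℝ) (ha : 0 ≤ a) (hb : 0 ≤ b)
      (hab : a + b = 1), f ⟨a • (x : EuclideanSpace ℝ (Fin d)) +
        b • (y : EuclideanSpace ℝ (Fin d)), hconv x.2 y.2 ha hb hab⟩ ≤ a * f x + b * f y} :=
    Set.ext (mem_convexContinuousOn_iff hconv)
  rw [this]
  simp only [Set.ofPred_forall]
  refine isClosed_iInter fun x => isClosed_iInter fun y => isClosed_iInter fun a =>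
    isClosed_iInter fun b => isClosed_iInter fun _ => isClosed_iInter fun _ =>
    isClosed_iInter fun _ => ?_
  exact isClosed_le (by fun_prop) (by fun_prop)

/-! ### Lipschitz extension and semiconvex truncation -/

/-- Infimal convolution with a multiple of the norm: a continuous convex function on a compact
convex set is approximated on it by convex Lipschitz functions on the whole space. -/
theorem exists_convexOn_univ_lipschitz_approx {E : Type*} [NormedAddCommGroup E]
    [NormedSpace ℝ E] {K : Set E} (hcomp : IsCompact K) (hne : K.Nonempty) {F : E → ℝ}
    (hF : ConvexOn ℝ K F) (hcont : ContinuousOn F K) {ε : ℝ} (hε : 0 < ε) :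
    ∃ (G : E → ℝ) (N M : ℝ), 0 ≤ N ∧ ConvexOn ℝ Set.univ G ∧
      (∀ x y, |G x - G y| ≤ N * ‖x - y‖) ∧ (∀ x, M ≤ G x) ∧ ∀ x ∈ K, |F x - G x| ≤ ε := by
  obtain ⟨C, hC⟩ := hcomp.exists_bound_of_continuousOn hcont
  have hC0 : 0 ≤ C := (norm_nonneg _).trans (hC _ hne.some_mem)
  obtain ⟨δ, hδ, hFδ⟩ := Metric.uniformContinuousOn_iff.mp
    (hcomp.uniformContinuousOn_of_continuous hcont) ε hε
  -- A minimizer at distance at least δ pays a penalty of at least 2C, which bounds the oscillation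
  -- of F.
  set N : ℝ := 2 * C / δ with hN
  have hN0 : 0 ≤ N := by positivity
  have hmin (x : E) : ∃ y ∈ K, ∀ z ∈ K, F y + N * ‖x - y‖ ≤ F z + N * ‖x - z‖ := by
    obtain ⟨y, hy, h⟩ := hcomp.exists_isMinOn hne
      (f := fun y => F y + N * ‖x - y‖) (hcont.add (by fun_prop))
    exact ⟨y, hy, fun z hz => h hz⟩
  choose p hpK hp using hmin
  refine ⟨fun x => F (p x) + N * ‖x - p x‖, N, -C, hN0, ⟨convex_univ, ?_⟩, ?_, ?_, ?_⟩
  · intro x _ y _ a b ha hb hab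
    have h1 := hp (a • x + b • y) _ (hF.1 (hpK x) (hpK y) ha hb hab)
    have h2 := hF.2 (hpK x) (hpK y) ha hb hab
    have h3 : ‖a • x + b • y - (a • p x + b • p y)‖ ≤ a * ‖x - p x‖ + b * ‖y - p y‖ := by
      have : a • x + b • y - (a • p x + b • p y) = a • (x - p x) + b • (y - p y) := by module
      rw [this]
      refine (norm_add_le _ _).trans_eq ?_
      rw [norm_smul, norm_smul, Real.norm_of_nonneg ha, Real.norm_of_nonneg hb]
    have h4 := mul_le_mul_of_nonneg_left h3 hN0
    simp only [smul_eq_mul] at h2 ⊢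
    linarith
  · have key (x y : E) : F (p x) + N * ‖x - p x‖ ≤ F (p y) + N * ‖y - p y‖ + N * ‖x - y‖ := by
      have h1 := hp x _ (hpK y)
      have h2 := mul_le_mul_of_nonneg_left (norm_sub_le_norm_sub_add_norm_sub x y (p y)) hN0
      linarith
    intro x y
    have h1 := key x y
    have h2 := key y x
    rw [norm_sub_rev y x] at h2
    rw [abs_le]
    constructor <;> linarith
  · intro x
    have h1 := (abs_le.mp (hC _ (hpK x))).1
    have : 0 ≤ N * ‖x - p x‖ := by positivity
    linarith
  · intro x hx
    have h1 := hp x x hx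
    simp only [sub_self, norm_zero, mul_zero, add_zero] at h1
    rw [abs_of_nonneg (by linarith)]
    by_cases h : ‖x - p x‖ < δ
    · have h2 := hFδ x hx _ (hpK x) (by rwa [dist_eq_norm])
      have h3 := (abs_lt.mp h2).2
      have : 0 ≤ N * ‖x - p x‖ := by positivity
      linarith
    · have h2 : N * δ ≤ N * ‖x - p x‖ := mul_le_mul_of_nonneg_left (not_lt.mp h) hN0
      have h3 : N * δ = 2 * C := by rw [hN]; field_simp
      have h4 := (abs_le.mp (hC _ (hpK x))).1
      have h5 := (abs_le.mp (hC _ hx)).2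
      linarith

theorem convexOn_norm_sq {E : Type*} [NormedAddCommGroup E] [InnerProductSpace ℝ E] {s : Set E}
    (hs : Convex ℝ s) {A : ℝ} (hA : 0 ≤ A) : ConvexOn ℝ s fun x => A * ‖x‖ ^ 2 :=
  ((convexOn_norm hs).pow (fun _ _ => norm_nonneg _) 2).smul hA

/-- The Huber function `‖x‖ ^ 2 - dist(x, closedBall 0 R) ^ 2` is convex. -/
theorem convexOn_norm_sq_sub_max_sq {E : Type*} [NormedAddCommGroup E] [InnerProductSpace ℝ E]
    {R : ℝ} (hR : 0 ≤ R) :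
    ConvexOn ℝ Set.univ fun x : E => ‖x‖ ^ 2 - max (‖x‖ - R) 0 ^ 2 := by
  -- The function is a supremum of affine functions of x indexed by the ball, attained at the
  -- projection of x onto the ball.
  have hle (x y : E) (hy : ‖y‖ ≤ R) :
      2 * inner ℝ x y - ‖y‖ ^ 2 ≤ ‖x‖ ^ 2 - max (‖x‖ - R) 0 ^ 2 := by
    have h1 := real_inner_le_norm x y
    rcases le_total ‖x‖ R with h | h
    · rw [max_eq_right (by linarith)]
      nlinarith [sq_nonneg (‖x‖ - ‖y‖)]
    · rw [max_eq_left (by linarith)]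
      nlinarith [mul_nonneg (sub_nonneg.mpr hy) (sub_nonneg.mpr h), sq_nonneg (R - ‖y‖)]
  have heq (z : E) : ∃ y : E, ‖y‖ ≤ R ∧
      ‖z‖ ^ 2 - max (‖z‖ - R) 0 ^ 2 = 2 * inner ℝ z y - ‖y‖ ^ 2 := by
    rcases le_total ‖z‖ R with h | h
    · refine ⟨z, h, ?_⟩
      rw [max_eq_right (by linarith), real_inner_self_eq_norm_sq]
      ring
    · rcases hR.eq_or_lt with h0 | h0
      · refine ⟨0, by simpa using hR, ?_⟩
        subst h0
        simp
      · have hz : ‖z‖ ≠ 0 := (h0.trans_le h).ne'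
        have hn : ‖(R / ‖z‖) • z‖ = R := by
          rw [norm_smul, Real.norm_of_nonneg (by positivity), div_mul_cancel₀ _ hz]
        refine ⟨(R / ‖z‖) • z, hn.le, ?_⟩
        rw [hn, max_eq_left (by linarith), real_inner_smul_right, real_inner_self_eq_norm_sq]
        field_simp
        ring
  refine ⟨convex_univ, fun x _ y _ a b ha hb hab => ?_⟩
  obtain ⟨w, hw, h⟩ := heq (a • x + b • y)
  have h1 := mul_le_mul_of_nonneg_left (hle x w hw) ha
  have h2 := mul_le_mul_of_nonneg_left (hle y w hw) hb
  simp only [smul_eq_mul]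
  rw [h, inner_add_left, real_inner_smul_left, real_inner_smul_left]
  have h3 : ‖w‖ ^ 2 = a * ‖w‖ ^ 2 + b * ‖w‖ ^ 2 := by rw [← add_mul, hab, one_mul]
  linarith

/-- A nonnegative convex Lipschitz function agrees on a given ball with a semiconvex function
vanishing outside a larger ball. -/
theorem exists_semiconvex_truncation {E : Type*} [NormedAddCommGroup E] [InnerProductSpace ℝ E]
    {G : E → ℝ} {N : ℝ} (hG : ConvexOn ℝ Set.univ G) (hN : 0 ≤ N)
    (hL : ∀ x y, |G x - G y| ≤ N * ‖x - y‖) (hG0 : ∀ x, 0 ≤ G x) {R : ℝ} (hR : 0 ≤ R) :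
    ∃ (f : E → ℝ) (A : ℝ), 0 ≤ A ∧ Continuous f ∧ (∀ x, ‖x‖ ≤ R → f x = G x) ∧
      (∀ x, R + 1 ≤ ‖x‖ → f x = 0) ∧ ConvexOn ℝ Set.univ fun x => f x + A * ‖x‖ ^ 2 := by
  have hGc : Continuous G :=
    (LipschitzWith.of_dist_le_mul (K := ⟨N, hN⟩) fun x y => by
      simpa only [Real.dist_eq, dist_eq_norm, NNReal.coe_mk] using! hL x y).continuous
  have hA : 0 ≤ G 0 + N * (R + 1) := add_nonneg (hG0 0) (by positivity)
  -- With t = ‖x‖ - R ≥ 1, this A gives G x ≤ G 0 + N(R + t) ≤ A t ≤ A t².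
  set A := G 0 + N * (R + 1) with hAdef
  refine ⟨fun x => max (G x - A * max (‖x‖ - R) 0 ^ 2) 0, A, hA, by fun_prop, ?_, ?_, ?_⟩
  · intro x hx
    simp [max_eq_right (sub_nonpos.mpr hx), hG0 x]
  · intro x hx
    refine max_eq_right (sub_nonpos.mpr ?_)
    rw [max_eq_left (by linarith)]
    have h1 := (abs_le.mp (hL x 0)).2
    rw [sub_zero] at h1
    have ht : 1 ≤ ‖x‖ - R := by linarith
    calc G x ≤ G 0 + N * ‖x‖ := by linarith
      _ ≤ A * (‖x‖ - R) := by
        have h2 := mul_nonneg (hG0 0) (sub_nonneg.mpr ht)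
        have h3 := mul_nonneg (mul_nonneg hN hR) (sub_nonneg.mpr ht)
        rw [hAdef]
        linarith
      _ ≤ A * (‖x‖ - R) ^ 2 := by
        refine mul_le_mul_of_nonneg_left ?_ hA
        nlinarith
  -- Adding A‖x‖² inside the maximum gives the larger of G + A·(Huber function) and A‖x‖², both
  -- convex.
  · have h := (hG.add ((convexOn_norm_sq_sub_max_sq hR).smul hA)).sup
      (convexOn_norm_sq (E := E) convex_univ hA)
    refine h.congr fun x _ => ?_
    simp only [Pi.sup_apply, Pi.add_apply, smul_eq_mul, ← max_add_add_right, zero_add]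
    congr 1
    ring

/-! ### Peak kernels -/

open MeasureTheory Filter Topology in
/-- Exponential polynomials contain approximate identities on every ball. -/
theorem exists_expPolynomial_peak (d : ℕ) {ρ η : ℝ} (hρ : 0 < ρ) (hη : 0 < η) :
    ∃ k ∈ expPolynomials d,
      (∀ s ∈ Metric.closedBall (0 : EuclideanSpace ℝ (Fin d)) ρ, 0 ≤ k s) ∧
      ∫ s in Metric.closedBall (0 : EuclideanSpace ℝ (Fin d)) ρ, k s = 1 ∧
      ∫ s in Metric.closedBall (0 : EuclideanSpace ℝ (Fin d)) ρ, k s * ‖s‖ < η := by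
  set Q := Metric.closedBall (0 : EuclideanSpace ℝ (Fin d)) ρ with hQ
  have hQc : IsCompact Q := isCompact_closedBall _ _
  have hmem : (fun s : EuclideanSpace ℝ (Fin d) => ∑ i, (Real.exp (s i) + -1) ^ 2) ∈
      expPolynomials d :=
    expPolynomials_sum _ fun i =>
      expPolynomials_pow (expPolynomials_add (expPolynomials_exp i) (expPolynomials_const _)) 2
  set S : EuclideanSpace ℝ (Fin d) → ℝ := fun s => ∑ i, (Real.exp (s i) + -1) ^ 2
  have hSc : Continuous S := expPolynomials_continuous hmem
  obtain ⟨C, hC⟩ := hQc.exists_bound_of_continuousOn hSc.continuousOn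
  have hS0 (s) : 0 ≤ S s := Finset.sum_nonneg fun i _ => sq_nonneg _
  have hSzero : S 0 = 0 := by simp [S]
  have hC0 : 0 ≤ C := (norm_nonneg _).trans (hC 0 (Metric.mem_closedBall_self hρ.le))
  -- On Q, q is nonnegative with its unique maximum at 0, so its normalized powers concentrate
  -- there.
  set q : EuclideanSpace ℝ (Fin d) → ℝ := fun s => 1 + -(1 / (C + 1)) * S s
  have hqmem : q ∈ expPolynomials d :=
    expPolynomials_add (expPolynomials_const _) (expPolynomials_mul (expPolynomials_const _) hmem)
  have hqc : Continuous q := expPolynomials_continuous hqmem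
  have hq0 : q 0 = 1 := by simp [q, hSzero]
  have hqnn (s) (hs : s ∈ Q) : 0 ≤ q s := by
    have h1 : S s ≤ C := (le_abs_self _).trans (hC s hs)
    have h2 : 1 / (C + 1) * S s ≤ 1 := by
      rw [one_div_mul_eq_div, div_le_one (by linarith)]
      linarith
    simp only [q]
    linarith
  have hqlt (s) (_ : s ∈ Q) (hs : s ≠ 0) : q s < q 0 := by
    have hpos : 0 < S s := by
      refine (hS0 s).lt_of_ne fun h => hs ?_
      ext i
      have := (Finset.sum_eq_zero_iff_of_nonneg fun i _ => sq_nonneg _).mp h.symm i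
        (Finset.mem_univ i)
      have h2 : Real.exp (s i) = 1 := by linarith [pow_eq_zero_iff two_ne_zero |>.mp this]
      simpa using h2
    have : 0 < 1 / (C + 1) * S s := by positivity
    rw [hq0]
    simp only [q]
    linarith
  have h0 : (0 : EuclideanSpace ℝ (Fin d)) ∈ closure (interior Q) :=
    subset_closure (mem_interior_iff_mem_nhds.mpr (Metric.closedBall_mem_nhds _ hρ))
  have hlim {g : EuclideanSpace ℝ (Fin d) → ℝ} (hg : Continuous g) :=
    tendsto_setIntegral_pow_smul_of_unique_maximum_of_isCompact_of_continuousOn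
      (μ := volume) hQc hqc.continuousOn hqlt hqnn (by rw [hq0]; exact one_pos) h0 hg.continuousOn
  have h1 := (hlim (continuous_const (y := (1 : ℝ)))).eventually_ne one_ne_zero
  have h2 := (hlim continuous_norm).eventually_lt_const (u := η) (by simpa using hη)
  obtain ⟨n, hn1, hn2⟩ := (h1.and h2).exists
  have hI : ∫ s in Q, q s ^ n ≠ 0 := fun h => hn1 (by simp [h])
  have hI0 : 0 ≤ ∫ s in Q, q s ^ n :=
    setIntegral_nonneg hQc.measurableSet fun s hs => pow_nonneg (hqnn s hs) n
  refine ⟨fun s => (∫ s in Q, q s ^ n)⁻¹ * q s ^ n,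
    expPolynomials_mul (expPolynomials_const _) (expPolynomials_pow hqmem n),
    fun s hs => mul_nonneg (inv_nonneg.mpr hI0) (pow_nonneg (hqnn s hs) n), ?_, ?_⟩
  · rw [integral_const_mul, inv_mul_cancel₀ hI]
  · simpa only [mul_assoc, integral_const_mul, smul_eq_mul] using hn2

/-! ### Strong convexity and control of the convexity defect -/

/-- On a bounded convex set, the sum of the coordinate exponentials is strongly convex. -/
theorem exists_convexOn_sum_exp_sub {d : ℕ} {K : Set (EuclideanSpace ℝ (Fin d))}
    (hconv : Convex ℝ K) {R : ℝ} (hR : ∀ x ∈ K, ‖x‖ ≤ R) :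
    ∃ c > 0, ConvexOn ℝ K fun x => ∑ i, Real.exp (x i) - c * ‖x‖ ^ 2 := by
  set c := Real.exp (-R) / 2 with hc
  have hd (t : ℝ) : HasDerivAt (fun t => Real.exp t - c * t ^ 2) (Real.exp t - c * (2 * t)) t := by
    simpa using! (Real.hasDerivAt_exp t).sub ((hasDerivAt_pow 2 t).const_mul c)
  have hd' : deriv (fun t => Real.exp t - c * t ^ 2) = fun t => Real.exp t - c * (2 * t) :=
    funext fun t => (hd t).deriv
  have hd2 (t : ℝ) : HasDerivAt (fun t => Real.exp t - c * (2 * t)) (Real.exp t - c * 2) t := by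
    simpa using! (Real.hasDerivAt_exp t).sub (((hasDerivAt_id t).const_mul 2).const_mul c)
  have h1 : ConvexOn ℝ (Set.Icc (-R) R) fun t => Real.exp t - c * t ^ 2 := by
    refine convexOn_of_deriv2_nonneg' (convex_Icc _ _)
      (fun t _ => (hd t).differentiableAt.differentiableWithinAt) ?_ fun t ht => ?_
    · rw [hd']
      exact fun t _ => (hd2 t).differentiableAt.differentiableWithinAt
    · rw [Function.iterate_succ_apply, Function.iterate_one, hd', (hd2 t).deriv, hc]
      have := Real.exp_le_exp.mpr ht.1
      linarith
  refine ⟨c, by positivity, hconv, fun x hx y hy a b ha hb hab => ?_⟩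
  have hmem {z : EuclideanSpace ℝ (Fin d)} (hz : z ∈ K) (i : Fin d) : z i ∈ Set.Icc (-R) R :=
    abs_le.mp ((PiLp.norm_apply_le z i).trans (hR z hz))
  have h2 := Finset.sum_le_sum fun i (_ : i ∈ Finset.univ) =>
    h1.2 (hmem hx i) (hmem hy i) ha hb hab
  simpa only [EuclideanSpace.real_norm_sq_eq, Finset.mul_sum, ← Finset.sum_sub_distrib,
    Finset.sum_add_distrib, smul_eq_mul, PiLp.add_apply, PiLp.smul_apply] using h2

open MeasureTheory in
/-- A compactly supported semiconvex function that is convex near `K` is approximated on `K` by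
almost convex exponential polynomials. -/
theorem exists_expPolynomial_almost_convexOn {d : ℕ} {K : Set (EuclideanSpace ℝ (Fin d))}
    (hconv : Convex ℝ K) {f G : EuclideanSpace ℝ (Fin d) → ℝ} {r R N A : ℝ} (hr : 0 ≤ r)
    (hK : ∀ x ∈ K, ‖x‖ ≤ r) (hG : ConvexOn ℝ Set.univ G) (hN : 0 ≤ N)
    (hL : ∀ x y, |G x - G y| ≤ N * ‖x - y‖) (hf : Continuous f)
    (hfG : ∀ x, ‖x‖ ≤ r + 1 → f x = G x) (hR : 0 < R) (hf0 : ∀ x, R ≤ ‖x‖ → f x = 0)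
    (hA : 0 ≤ A) (hfA : ConvexOn ℝ Set.univ fun x => f x + A * ‖x‖ ^ 2) {η : ℝ} (hη : 0 < η) :
    ∃ P ∈ expPolynomials d, ConvexOn ℝ K (fun x => P x + η * ‖x‖ ^ 2) ∧
      ∀ x ∈ K, |P x - f x| ≤ η := by
  have hfs : HasCompactSupport f :=
    HasCompactSupport.intro (isCompact_closedBall 0 R) fun x hx => hf0 x (by
      rw [Metric.mem_closedBall, dist_zero_right] at hx
      exact (not_le.mp hx).le)
  obtain ⟨M, hM⟩ := hfs.exists_bound_of_continuous hf
  have hM0 : 0 ≤ M := (norm_nonneg _).trans (hM 0)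
  set L := N + 2 * M with hLdef
  have hL0 : 0 ≤ L := by positivity
  have hfL (x) (hx : x ∈ K) (s : EuclideanSpace ℝ (Fin d)) : |f (x - s) - f x| ≤ L * ‖s‖ := by
    rcases le_total ‖s‖ 1 with hs | hs
    · have hxs : ‖x - s‖ ≤ r + 1 := (norm_sub_le _ _).trans (add_le_add (hK x hx) hs)
      rw [hfG _ hxs, hfG x (by linarith [hK x hx])]
      refine (hL _ _).trans ?_
      rw [sub_sub_cancel_left, norm_neg]
      exact mul_le_mul_of_nonneg_right (by linarith) (norm_nonneg _)
    · have h1 : |f (x - s) - f x| ≤ 2 * M :=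
        (norm_sub_le (f (x - s)) (f x)).trans (by linarith [hM (x - s), hM x])
      nlinarith
  -- For x in K and s outside this ball, x - s lies outside the support of f.
  set Q := Metric.closedBall (0 : EuclideanSpace ℝ (Fin d)) (r + R) with hQ
  have hQc : IsCompact Q := isCompact_closedBall _ _
  obtain ⟨k, hk, hk0, hk1, hkη⟩ := exists_expPolynomial_peak d (ρ := r + R)
    (η := η / (A + L + 1)) (by positivity) (by positivity)
  rw [← hQ] at hk0 hk1 hkη
  have hkc : Continuous k := expPolynomials_continuous hk
  have hint {g : EuclideanSpace ℝ (Fin d) → ℝ} (hg : Continuous g) : IntegrableOn g Q :=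
    hg.continuousOn.integrableOn_compact hQc
  set m := ∫ s in Q, k s * ‖s‖ with hm
  have hm0 : 0 ≤ m := setIntegral_nonneg hQc.measurableSet fun s hs =>
    mul_nonneg (hk0 s hs) (norm_nonneg s)
  have hmη : (A + L + 1) * m ≤ η := by
    rw [lt_div_iff₀ (by positivity)] at hkη
    linarith
  have hP (x) (hx : x ∈ K) : ∫ t, f t * k (x - t) = ∫ s in Q, f (x - s) * k s := by
    rw [setIntegral_eq_integral_of_forall_compl_eq_zero,
      ← integral_sub_left_eq_self (fun t => f t * k (x - t)) volume x]
    · simp only [sub_sub_cancel]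
    · intro s hs
      rw [hQ, Metric.mem_closedBall, dist_zero_right, not_le] at hs
      rw [hf0, zero_mul]
      have := norm_sub_norm_le s x
      rw [norm_sub_rev] at this
      linarith [hK x hx]
  -- For ‖s‖ ≤ 1 the translate is that of G, already convex; for ‖s‖ ≥ 1 semiconvexity suffices, as
  -- A ≤ A‖s‖ and ‖x - s‖² - ‖x‖² is affine in x.
  have hψ (s : EuclideanSpace ℝ (Fin d)) :
      ConvexOn ℝ K fun x => f (x - s) + A * ‖s‖ * ‖x‖ ^ 2 := by
    rcases le_total ‖s‖ 1 with hs | hs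
    · have h1 : ConvexOn ℝ K fun x => G (x - s) := by
        simpa [sub_eq_add_neg, Function.comp_def] using
          (hG.translate_left (-s)).subset (Set.subset_univ K) hconv
      refine (h1.add (convexOn_norm_sq hconv (A := A * ‖s‖) (by positivity))).congr fun x hx => ?_
      simp only [Pi.add_apply]
      rw [hfG _ ((norm_sub_le _ _).trans (add_le_add (hK x hx) hs))]
    · have h1 : ConvexOn ℝ K fun x => f (x - s) + A * ‖x - s‖ ^ 2 := by
        simpa [sub_eq_add_neg, Function.comp_def] using
          (hfA.translate_left (-s)).subset (Set.subset_univ K) hconv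
      have h2 : ConvexOn ℝ K fun x => A * (2 * inner ℝ s x - ‖s‖ ^ 2) := by
        refine ⟨hconv, fun x _ y _ a b _ _ hab => le_of_eq ?_⟩
        simp only [inner_add_right, real_inner_smul_right, smul_eq_mul]
        obtain rfl : b = 1 - a := by linarith
        ring
      refine ((h1.add h2).add (convexOn_norm_sq hconv (A := A * (‖s‖ - 1))
        (mul_nonneg hA (by linarith)))).congr fun x _ => ?_
      simp only [Pi.add_apply]
      rw [norm_sub_sq_real, real_inner_comm]
      ring
  refine ⟨_, expPolynomials_convolution hf hfs hk, ?_, ?_⟩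
  · have hrep (x) (hx : x ∈ K) : ∫ t, f t * k (x - t) =
        (∫ s in Q, (f (x - s) + A * ‖s‖ * ‖x‖ ^ 2) * k s) - A * m * ‖x‖ ^ 2 := by
      have h1 (s : EuclideanSpace ℝ (Fin d)) : (f (x - s) + A * ‖s‖ * ‖x‖ ^ 2) * k s =
          f (x - s) * k s + A * ‖x‖ ^ 2 * (k s * ‖s‖) := by ring
      simp only [h1]
      rw [hP x hx, integral_add (hint (by fun_prop)) (hint (by fun_prop)), integral_const_mul]
      ring
    have h1 : ConvexOn ℝ K fun x => ∫ s in Q, (f (x - s) + A * ‖s‖ * ‖x‖ ^ 2) * k s := by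
      refine ⟨hconv, fun x hx y hy a b ha hb hab => ?_⟩
      simp only [smul_eq_mul]
      rw [← integral_const_mul, ← integral_const_mul,
        ← integral_add (hint (by fun_prop)) (hint (by fun_prop))]
      refine setIntegral_mono_on (hint (by fun_prop)) (hint (by fun_prop)) hQc.measurableSet
        fun s hs => ?_
      have h2 := mul_le_mul_of_nonneg_right ((hψ s).2 hx hy ha hb hab) (hk0 s hs)
      simp only [smul_eq_mul] at h2
      linarith
    refine (h1.add (convexOn_norm_sq hconv (A := η - A * m) ?_)).congr fun x hx => ?_
    · nlinarith
    · simp only [Pi.add_apply]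
      rw [hrep x hx]
      ring
  · intro x hx
    rw [hP x hx]
    have h1 : (∫ s in Q, f (x - s) * k s) - f x = ∫ s in Q, (f (x - s) - f x) * k s := by
      simp only [sub_mul]
      rw [integral_sub (hint (by fun_prop)) (hint (by fun_prop)), integral_const_mul, hk1, mul_one]
    rw [h1]
    calc |∫ s in Q, (f (x - s) - f x) * k s| ≤ ∫ s in Q, |(f (x - s) - f x) * k s| :=
          abs_integral_le_integral_abs
      _ ≤ ∫ s in Q, L * (k s * ‖s‖) := by
        refine setIntegral_mono_on (hint (by fun_prop)) (hint (by fun_prop)) hQc.measurableSet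
          fun s hs => ?_
        rw [abs_mul, abs_of_nonneg (hk0 s hs)]
        have h2 := mul_le_mul_of_nonneg_right (hfL x hx s) (hk0 s hs)
        linarith
      _ ≤ η := by
        rw [integral_const_mul]
        nlinarith

/-! ### Assembly -/

/-- A continuous convex function on a nonempty compact convex set is uniformly approximated there
by convex exponential polynomials. -/
theorem exists_convexOn_expPolynomial_approx {d : ℕ} {K : Set (EuclideanSpace ℝ (Fin d))}
    (hcomp : IsCompact K) (hne : K.Nonempty) {F : EuclideanSpace ℝ (Fin d) → ℝ}
    (hF : ConvexOn ℝ K F) (hcont : ContinuousOn F K) {ε : ℝ} (hε : 0 < ε) :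
    ∃ E ∈ expPolynomials d, ConvexOn ℝ K E ∧ ∀ x ∈ K, |F x - E x| ≤ ε := by
  obtain ⟨r, hr⟩ := hcomp.isBounded.exists_norm_le
  have hr0 : 0 ≤ r := (norm_nonneg _).trans (hr _ hne.some_mem)
  obtain ⟨G, N, M, hN, hG, hL, hM, hFG⟩ :=
    exists_convexOn_univ_lipschitz_approx hcomp hne hF hcont (ε := ε / 3) (by positivity)
  have hL' (x y) : |(G x + -M) - (G y + -M)| ≤ N * ‖x - y‖ := by
    simpa only [add_sub_add_right_eq_sub] using hL x y
  have hG' : ConvexOn ℝ Set.univ fun x => G x + -M := hG.add_const (-M)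
  -- The radius r + 1 leaves room for shifts of norm at most 1.
  obtain ⟨f, A, hA, hfc, hfG, hf0, hfA⟩ := exists_semiconvex_truncation hG' hN hL'
    (fun x => by linarith [hM x]) (R := r + 1) (by positivity)
  obtain ⟨c, hc, hS⟩ := exists_convexOn_sum_exp_sub hF.1 hr
  have hSmem : (fun x : EuclideanSpace ℝ (Fin d) => ∑ i, Real.exp (x i)) ∈ expPolynomials d :=
    expPolynomials_sum _ expPolynomials_exp
  obtain ⟨B, hB⟩ :=
    hcomp.exists_bound_of_continuousOn (expPolynomials_continuous hSmem).continuousOn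
  have hB0 : 0 ≤ B := (norm_nonneg _).trans (hB _ hne.some_mem)
  -- The correction δ∑ exp(x_i) costs at most ε/3 on K and supplies strong convexity δc, which
  -- bounds the allowed defect.
  set δ := ε / (3 * (B + 1)) with hδ
  have hδ0 : 0 < δ := by positivity
  have hδB : δ * B ≤ ε / 3 := by
    have : δ * (B + 1) = ε / 3 := by rw [hδ]; field_simp
    linarith
  obtain ⟨P, hP, hPc, hPf⟩ := exists_expPolynomial_almost_convexOn hF.1 hr0 hr hG' hN hL' hfc hfG
    (R := r + 1 + 1) (by positivity) hf0 hA hfA (η := min (δ * c) (ε / 3)) (by positivity)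
  refine ⟨_, expPolynomials_add (expPolynomials_add hP (expPolynomials_const M))
    (expPolynomials_mul (expPolynomials_const δ) hSmem), ?_, fun x hx => ?_⟩
  · refine (((hPc.add_const M).add (hS.smul hδ0.le)).add (convexOn_norm_sq hF.1
      (sub_nonneg.mpr (min_le_left (δ * c) (ε / 3))))).congr fun x _ => ?_
    simp only [Pi.add_apply, smul_eq_mul]
    ring
  · have h1 := abs_le.mp (hFG x hx)
    have h2 := abs_le.mp ((hPf x hx).trans (min_le_right _ _))
    rw [hfG x (by linarith [hr x hx])] at h2
    have h3 := (abs_le.mp (hB x hx)).2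
    have h4 : 0 ≤ ∑ i, Real.exp (x i) := Finset.sum_nonneg fun i _ => (Real.exp_pos _).le
    have h5 := mul_le_mul_of_nonneg_left h3 hδ0.le
    have h6 := mul_nonneg hδ0.le h4
    rw [abs_le]
    constructor <;> linarith [h1.1, h1.2, h2.1, h2.2]

/-- For compact `K` the topology of `C(K, ℝ)` is that of the uniform norm on `K`, so `closure`
is the closure with respect to uniform convergence on `K`. -/
theorem mainTheorem5 (d : ℕ) (K : Set (EuclideanSpace ℝ (Fin d)))
    (hconv : Convex ℝ K) (hcomp : IsCompact K) :
    convexContinuousOn K = closure (expPolynomialsOn K ∩ convexContinuousOn K) := by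
  have : CompactSpace K := isCompact_iff_compactSpace.mp hcomp
  refine Set.Subset.antisymm ?_
    (closure_minimal Set.inter_subset_right (isClosed_convexContinuousOn hconv))
  rintro f ⟨F, hF, hfF⟩
  rcases K.eq_empty_or_nonempty with hK | hne
  · subst hK
    exact subset_closure ⟨⟨_, expPolynomials_const 0, fun x => x.2.elim⟩, F, hF, hfF⟩
  have hcont : ContinuousOn F K := by
    rw [continuousOn_iff_continuous_domRestrict]
    exact f.continuous.congr hfF
  refine Metric.mem_closure_iff.mpr fun ε hε => ?_
  obtain ⟨E, hE, hEc, hEF⟩ :=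
    exists_convexOn_expPolynomial_approx hcomp hne hF hcont (half_pos hε)
  refine ⟨⟨fun x => E x, (expPolynomials_continuous hE).comp continuous_subtype_val⟩,
    ⟨⟨E, hE, fun _ => rfl⟩, E, hEc, fun _ => rfl⟩, ?_⟩
  refine (ContinuousMap.dist_lt_iff hε).mpr fun x => ?_
  rw [Real.dist_eq, hfF]
  exact (hEF x x.2).trans_lt (half_lt_self hε)
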